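/- All lattices are finite and nonempty, and all matroids have finite ground sets. A flat $X$ of a matroid $M$ is cyclic if the restriction $M|X$ has no isthmuses (coloops); ordered by inclusion, the cyclic flats of $M$ form a lattice $\mathcal{Z}(M)$. A matroid is transversal if there is a finite indexed family of subsets of its ground set whose partial transversals are exactly the independent sets of the matroid. A lattice $L$ is a Tr-lattice if every matroid $M$ with $\mathcal{Z}(M)$ isomorphic to $L$ is transversal. The width of an ordered set is the maximal cardinality of an antichain in it. For a lattice $L$ and a family $\mathcal{L}=(L_x : x\in L)$ of lattices, the lexicographic sum $L\oplus\mathcal{L}$ is the set $\{(x,a) : x\in L,\ a\in L_x\}$ ordered by $(x,a)\le (y,b)$ if and only if either (i) $x<y$ in $L$, or (ii) $x=y$ and $a\le b$ in $L_x$. Theorem. Let $L$ be a lattice of width at most two and let $\mathcal{L}=(L_x : x\in L)$ be a family of Tr-lattices. Then $L\oplus\mathcal{L}$ is a lattice, and it is a Tr-lattice. -/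

import Mathlib

/-- `P` is a finite lattice: a finite nonempty ordered set in which any two elements have a
join and a meet. -/
structure IsFiniteLattice (P : Type*) [PartialOrder P] : Prop where
  finite : Finite P
  nonempty : Nonempty P
  exists_join : ∀ a b : P, ∃ c, IsLUB {a, b} c
  exists_meet : ∀ a b : P, ∃ c, IsGLB {a, b} c

/-- The width of an ordered set: the supremum of the cardinalities of its antichains. -/
noncomputable def orderWidth (P : Type*) [PartialOrder P] : ℕ∞ :=
  ⨆ (A : Set P) (_ : IsAntichain (· ≤ ·) A), A.encard

/-- A cyclic flat of a matroid `M`: a flat `X` such that the restriction of `M` to `X` has no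
isthmuses (that is, no coloops). -/
def Matroid.IsCyclicFlat {α : Type*} (M : Matroid α) (X : Set α) : Prop :=
  M.IsFlat X ∧ ∀ e, ¬ (M.restrict X).IsColoop e

/-- The cyclic flats of `M`, ordered by inclusion. -/
abbrev Matroid.CyclicFlats {α : Type*} (M : Matroid α) : Type _ :=
  {X : Set α // M.IsCyclicFlat X}

/-- `I` is a partial transversal of the family `A`: its elements can be matched to distinct
members of the family that contain them. -/
def IsPartialTransversal {α ι : Type*} (A : ι → Set α) (I : Set α) : Prop :=
  ∃ f : I → ι, Function.Injective f ∧ ∀ e : I, (e : α) ∈ A (f e)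

/-- `M` is transversal: its independent sets are the partial transversals of some finite family
of subsets of its ground set. -/
def Matroid.IsTransversal {α : Type*} (M : Matroid α) : Prop :=
  ∃ (m : ℕ) (A : Fin m → Set α), (∀ i, A i ⊆ M.E) ∧
    ∀ I : Set α, M.Indep I ↔ IsPartialTransversal A I

/-- `P` is a Tr-lattice: it is a finite lattice, and every finite matroid whose lattice of cyclic
flats is isomorphic to `P` is transversal. -/
structure IsTrLattice.{w, u} (P : Type u) [PartialOrder P] : Prop where
  isFiniteLattice : IsFiniteLattice P
  isTransversal : ∀ (α : Type w) (M : Matroid α), M.Finite →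
    Nonempty (M.CyclicFlats ≃o P) → M.IsTransversal

/-- The lexicographic sum of a family of ordered sets over `L`: the pairs `⟨x, a⟩` with `x : L`
and `a : F x`, where `⟨x, a⟩ ≤ ⟨y, b⟩` iff `x < y`, or `x = y` and `a ≤ b` in `F x`. -/
abbrev LexSum {L : Type*} (F : L → Type*) : Type _ := Lex (Sigma F)

universe w u v

open Set

/-! ### Sums over up-sets of a finite ordered set -/

section UpperSums

variable {P : Type*} [PartialOrder P] [Finite P]

/-! Give each cyclic flat Z of M the integer γ(Z) determined by ∑_{Y ≥ Z} γ(Y) = r(M) - r(Z). By the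
Mason–Ingleton criterion, M is transversal if ∑_{Z ∈ U} γ(Z) ≤ r(M) - r(S) for every up-set U of
cyclic flats and every S contained in all of them (`isTransversal_of_finsum_le`). Conversely, a
transversal matroid without coloops satisfies this inequality (`IsPresentation.finsum_le`).

Let the cyclic flats form a lexicographic sum over L. If the indices of the members of U have a
least element x, then U consists of part of the fibre over x and of everything above that fibre. The
inequality then reduces to the one for the minor M|t/b, with b and t the bottom and top of the fibre
(`finsum_le_of_interval`). The cyclic flats of this minor form L_x, so it is transversal.

Otherwise width two leaves exactly two minimal indices. U is the union of the up-sets over them, and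
these intersect in the principal up-set of the bottom of the fibre over their join.
Inclusion–exclusion and submodularity of rank combine the two inequalities already known
(`isTransversal_of_fibers`). -/

lemma finsum_mem_Ici_eq_add (γ : P → ℤ) (x : P) :
    ∑ᶠ y ∈ Ici x, γ y = γ x + ∑ᶠ y ∈ Ioi x, γ y := by
  rw [← Ioi_insert, finsum_mem_insert γ (by simp) (Set.toFinite _)]

/-- Möbius inversion by recursion from the top of P down. -/
lemma exists_finsum_mem_Ici_eq (f : P → ℤ) : ∃ γ : P → ℤ, ∀ x, ∑ᶠ y ∈ Ici x, γ y = f x := by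
  have wf : WellFounded (fun y x : P => x < y) := wellFounded_gt
  refine ⟨wf.fix fun x rec => f x - ∑ᶠ (y) (h : x < y), rec y h, fun x => ?_⟩
  rw [finsum_mem_Ici_eq_add, wf.fix_eq]
  simp only [mem_Ioi]
  ring

lemma eq_of_finsum_mem_Ici_eq {γ δ : P → ℤ}
    (h : ∀ x, ∑ᶠ y ∈ Ici x, γ y = ∑ᶠ y ∈ Ici x, δ y) : γ = δ := by
  funext x
  induction x using (wellFounded_gt (α := P)).induction with
  | _ x ih =>
    have hx := h x
    rw [finsum_mem_Ici_eq_add, finsum_mem_Ici_eq_add,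
      finsum_mem_congr (s := Ioi x) rfl (fun y hy => ih y hy)] at hx
    exact add_right_cancel hx

end UpperSums

lemma finsum_mem_ncard_fiber {ι P : Type*} [Finite ι] [Finite P] (m : ι → P) (I : Set ι) (U : Set P) :
    ∑ᶠ y ∈ U, (({i ∈ I | m i = y}).ncard : ℤ) = ({i ∈ I | m i ∈ U}).ncard := by
  classical
  have hU := U.toFinite
  rw [finsum_mem_eq_finite_toFinset_sum _ hU, ← Nat.cast_sum, Nat.cast_inj,
    Set.ncard_eq_toFinset_card _ (Set.toFinite _),
    Finset.card_eq_sum_card_fiberwise (f := m) (t := hU.toFinset) (by intro i hi; simpa using (by simpa using hi : i ∈ I ∧ m i ∈ U).2)]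
  refine Finset.sum_congr rfl fun y hy => ?_
  rw [Set.ncard_eq_toFinset_card _ (Set.toFinite _)]
  congr 1
  ext i
  have : y ∈ U := by simpa using hy
  simp only [Finite.mem_toFinset, mem_ofPred_eq, Finset.mem_filter]
  constructor
  · rintro ⟨h1, rfl⟩; exact ⟨⟨h1, this⟩, rfl⟩
  · rintro ⟨⟨h1, _⟩, h2⟩; exact ⟨h1, h2⟩

namespace Matroid

variable {α : Type*} {M : Matroid α} {X Y S C : Set α}

/-! ### Rank in a finite matroid -/

/-- The rank of a set in a matroid of finite rank, as a natural number. -/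
noncomputable def natRk (M : Matroid α) (X : Set α) : ℕ := (M.eRk X).toNat

lemma coe_natRk (M : Matroid α) [M.Finite] (X : Set α) : (M.natRk X : ℕ∞) = M.eRk X :=
  ENat.natCast_toNat (eRk_ne_top_iff.2 (M.isRkFinite_set X))

lemma natRk_mono (M : Matroid α) [M.Finite] (h : X ⊆ Y) : M.natRk X ≤ M.natRk Y := by
  have := M.eRk_mono h
  rw [← coe_natRk, ← coe_natRk] at this
  exact_mod_cast this

lemma natRk_inter_add_natRk_union_le (M : Matroid α) [M.Finite] (X Y : Set α) :
    M.natRk (X ∩ Y) + M.natRk (X ∪ Y) ≤ M.natRk X + M.natRk Y := by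
  have := M.eRk_inter_add_eRk_union_le X Y
  simp only [← coe_natRk] at this
  exact_mod_cast this

@[simp] lemma natRk_closure (M : Matroid α) (X : Set α) : M.natRk (M.closure X) = M.natRk X := by
  simp [natRk]

lemma IsBasis.ncard_eq_natRk {I : Set α} (h : M.IsBasis I X) : I.ncard = M.natRk X := by
  rw [natRk, ← h.encard_eq_eRk, Set.ncard]

lemma Indep.ncard_eq_natRk {I : Set α} (h : M.Indep I) : I.ncard = M.natRk I :=
  h.isBasis_self.ncard_eq_natRk

lemma finite_of_subset_ground [M.Finite] (h : X ⊆ M.E) : X.Finite := M.ground_finite.subset h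

lemma IsCircuit.natRk_add_one [M.Finite] (hC : M.IsCircuit C) : M.natRk C + 1 = C.ncard := by
  have h := hC.eRk_add_one_eq
  rw [← coe_natRk, ← (finite_of_subset_ground hC.subset_ground).cast_ncard_eq] at h
  exact_mod_cast h

/-! ### Cyclic sets -/

/-- A set is cyclic if it has no coloops in the restriction to it. -/
def IsCyclic (M : Matroid α) (X : Set α) : Prop := ∀ e ∈ X, e ∈ M.closure (X \ {e})

lemma IsCyclic.subset_ground (h : M.IsCyclic X) : X ⊆ M.E :=
  fun e he => M.closure_subset_ground _ (h e he)

lemma isCyclicFlat_iff : M.IsCyclicFlat X ↔ M.IsFlat X ∧ M.IsCyclic X := by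
  refine and_congr_right fun h => ?_
  simp only [restrict_isColoop_iff h.subset_ground, IsCyclic]
  exact forall_congr' fun e => by tauto

lemma isCyclic_empty (M : Matroid α) : M.IsCyclic ∅ := by simp [IsCyclic]

lemma IsCyclic.sUnion {T : Set (Set α)} (h : ∀ X ∈ T, M.IsCyclic X) : M.IsCyclic (⋃₀ T) := by
  rintro e ⟨X, hX, he⟩
  exact M.closure_subset_closure (sdiff_subset_sdiff_left (subset_sUnion_of_mem hX)) (h X hX e he)

lemma IsCyclic.union (hX : M.IsCyclic X) (hY : M.IsCyclic Y) : M.IsCyclic (X ∪ Y) := by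
  rw [← sUnion_pair]
  exact IsCyclic.sUnion (by simp [hX, hY])

lemma IsCyclic.closure (hX : M.IsCyclic X) : M.IsCyclic (M.closure X) := by
  have hss := M.subset_closure X hX.subset_ground
  intro e he
  by_cases heX : e ∈ X
  · exact M.closure_subset_closure (sdiff_subset_sdiff_left hss) (hX e heX)
  · exact M.closure_subset_closure (subset_sdiff_singleton hss heX) he

lemma IsCyclic.isCyclicFlat_closure (hX : M.IsCyclic X) : M.IsCyclicFlat (M.closure X) :=
  isCyclicFlat_iff.2 ⟨isFlat_closure X, hX.closure⟩

lemma IsCircuit.isCyclic (hC : M.IsCircuit C) : M.IsCyclic C :=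
  fun _ he => hC.mem_closure_sdiff_singleton_of_mem he

/-- If e ∈ B, some f ∈ X \ {e} lies outside the closure of B \ {e}, since otherwise e would lie in
that closure. The fundamental circuit of such an f must pass through e. -/
lemma IsCyclic.exists_fundCircuit {B : Set α} {e : α} (hX : M.IsCyclic X) (hB : M.IsBasis B X)
    (he : e ∈ X) : ∃ f ∉ B, ∃ C, M.IsCircuit C ∧ f ∈ C ∧ C \ {f} ⊆ B ∧ e ∈ C ∧ C ⊆ X := by
  have key : ∀ f ∈ X, f ∉ B → M.IsCircuit (M.fundCircuit f B) ∧ f ∈ M.fundCircuit f B ∧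
      M.fundCircuit f B \ {f} ⊆ B ∧ M.fundCircuit f B ⊆ X := fun f hf hfB =>
    ⟨hB.indep.fundCircuit_isCircuit (hB.subset_closure hf) hfB, M.mem_fundCircuit f B,
      by simpa using M.fundCircuit_subset_insert f B,
      (M.fundCircuit_subset_insert f B).trans (insert_subset hf hB.subset)⟩
  by_cases heB : e ∈ B
  · obtain ⟨f, hfX, hfB⟩ : ∃ f ∈ X \ {e}, f ∉ M.closure (B \ {e}) := by
      by_contra! hcon
      have := M.closure_subset_closure_of_subset_closure hcon (hX e he)
      exact hB.indep.notMem_closure_sdiff_of_mem heB this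
    have hfB' : f ∉ B := fun h =>
      hfB (M.mem_closure_of_mem' ⟨h, hfX.2⟩ (hB.indep.subset_ground h))
    obtain ⟨h1, h2, h3, h4⟩ := key f hfX.1 hfB'
    refine ⟨f, hfB', _, h1, h2, h3, by_contra fun heC => hfB ?_, h4⟩
    exact M.closure_subset_closure (subset_sdiff_singleton h3 fun h => heC h.1)
      (h1.mem_closure_sdiff_singleton_of_mem h2)
  · obtain ⟨h1, h2, h3, h4⟩ := key e he heB
    exact ⟨e, heB, _, h1, h2, h3, h2, h4⟩

instance [M.Finite] : Finite M.CyclicFlats := by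
  have := M.ground_finite.finite_subsets.to_subtype
  exact Finite.of_injective (fun Z : M.CyclicFlats =>
    (⟨Z.1, Z.2.1.subset_ground⟩ : {X : Set α | X ⊆ M.E})) fun Z Z' h =>
      Subtype.ext (Subtype.mk.inj h)

/-- The smallest cyclic flat containing a given cyclic set. -/
def IsCyclic.toFlat (hX : M.IsCyclic X) : M.CyclicFlats := ⟨M.closure X, hX.isCyclicFlat_closure⟩

lemma CyclicFlats.isCyclic (Z : M.CyclicFlats) : M.IsCyclic Z.1 := (isCyclicFlat_iff.1 Z.2).2

lemma CyclicFlats.closure_eq (Z : M.CyclicFlats) : M.closure Z.1 = Z.1 := Z.2.1.closure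

lemma IsCyclic.toFlat_le_iff (hX : M.IsCyclic X) {Z : M.CyclicFlats} :
    hX.toFlat ≤ Z ↔ X ⊆ Z.1 := by
  constructor
  · exact fun h => (M.subset_closure X hX.subset_ground).trans h
  · intro h
    change M.closure X ⊆ Z.1
    rw [← Z.closure_eq]
    exact M.closure_subset_closure h

end Matroid

/-! ### Partial transversals -/

section PartialTransversal

variable {α ι : Type*}

/-- The indices of the members of a family that meet a given set. -/
def meetingIndices (A : ι → Set α) (S : Set α) : Set ι := {i | (A i ∩ S).Nonempty}

lemma meetingIndices_mono (A : ι → Set α) {S T : Set α} (h : S ⊆ T) :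
    meetingIndices A S ⊆ meetingIndices A T :=
  fun _ hi => hi.mono (inter_subset_inter_right _ h)

lemma ncard_image_preimage_val {I S : Set α} {f : I → ι} (hf : Function.Injective f)
    (hS : S ⊆ I) : (f '' (Subtype.val ⁻¹' S)).ncard = S.ncard := by
  rw [ncard_image_of_injective _ hf,
    ncard_preimage_of_injective_subset_range Subtype.val_injective (by simpa using hS)]

lemma image_preimage_val_subset_meetingIndices {A : ι → Set α} {I S : Set α} {f : I → ι}
    (hfA : ∀ e : I, (e : α) ∈ A (f e)) : f '' (Subtype.val ⁻¹' S) ⊆ meetingIndices A S := by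
  rintro _ ⟨e, he, rfl⟩
  exact ⟨e, hfA e, he⟩

lemma IsPartialTransversal.ncard_le [Finite ι] {A : ι → Set α} {I S : Set α}
    (h : IsPartialTransversal A I) (hS : S ⊆ I) : S.ncard ≤ (meetingIndices A S).ncard := by
  obtain ⟨f, hf, hfA⟩ := h
  rw [← ncard_image_preimage_val hf hS]
  exact ncard_le_ncard (image_preimage_val_subset_meetingIndices hfA)

/-- Hall's marriage theorem. I may be infinite, and the condition is only needed on its finite
subsets. -/
lemma isPartialTransversal_of_forall_ncard_le [Finite ι] {A : ι → Set α} {I : Set α}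
    (h : ∀ S ⊆ I, S.Finite → S.ncard ≤ (meetingIndices A S).ncard) : IsPartialTransversal A I := by
  classical
  have := Fintype.ofFinite ι
  refine (Fintype.all_card_le_filter_rel_iff_exists_injective
    (fun (e : I) i => (e : α) ∈ A i)).1 fun T => ?_
  have := h (Subtype.val '' (T : Set I)) (by simp) (T.finite_toSet.image _)
  rw [ncard_image_of_injective _ Subtype.val_injective, ncard_coe_finset] at this
  refine this.trans (le_of_eq ?_)
  rw [← ncard_coe_finset]
  congr 1
  ext i
  simp only [meetingIndices, Set.Nonempty, Finset.coe_filter, mem_ofPred_eq, Finset.mem_univ,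
    true_and]
  constructor
  · rintro ⟨_, h1, e, h2, rfl⟩; exact ⟨e, h2, h1⟩
  · rintro ⟨e, h2, h1⟩; exact ⟨e, h1, e, h2, rfl⟩

end PartialTransversal

/-! ### Presentations and the Mason–Ingleton criterion -/

namespace Matroid

variable {α ι : Type*} {M : Matroid α} {A : ι → Set α}

/-- `A` is a presentation of `M` if the independent sets of `M` are the partial transversals
of `A`. -/
def IsPresentation (M : Matroid α) (A : ι → Set α) : Prop :=
  ∀ I : Set α, M.Indep I ↔ IsPartialTransversal A I

namespace IsPresentation

variable [Finite ι] {X S C : Set α}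

lemma natRk_le (hA : M.IsPresentation A) (hS : S ⊆ M.E) : M.natRk S ≤ (meetingIndices A S).ncard := by
  obtain ⟨I, hI⟩ := M.exists_isBasis S
  rw [← hI.ncard_eq_natRk]
  exact (((hA I).1 hI.indep).ncard_le subset_rfl).trans
    (ncard_le_ncard (meetingIndices_mono A hI.subset))

variable [M.Finite] (hA : M.IsPresentation A)
include hA

/-- Proper subsets of C are independent and satisfy Hall's condition, so Hall's condition must fail
at C itself. Hence C meets fewer than |C| members, while C \ {e} already meets at least |C| - 1. -/
lemma circuit {e : α} (hC : M.IsCircuit C) (he : e ∈ C) :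
    meetingIndices A C = meetingIndices A (C \ {e}) ∧
      (meetingIndices A (C \ {e})).ncard = (C \ {e}).ncard := by
  have hlt : (meetingIndices A C).ncard < C.ncard := by
    by_contra! hcon
    refine hC.not_indep ((hA C).2 (isPartialTransversal_of_forall_ncard_le fun S hS _ => ?_))
    obtain rfl | hne := eq_or_ne S C
    · exact hcon
    · exact ((hA S).1 (hC.ssubset_indep (hS.ssubset_of_ne hne))).ncard_le subset_rfl
  have hle := ((hA _).1 (hC.sdiff_singleton_indep he)).ncard_le subset_rfl
  have hcard := ncard_sdiff_singleton_add_one he (finite_of_subset_ground hC.subset_ground)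
  have hss := meetingIndices_mono A (sdiff_subset (s := C) (t := {e}))
  have hmono := ncard_le_ncard hss
  exact ⟨(eq_of_subset_of_ncard_le hss (by omega)).symm, by omega⟩

/-- The rank of a cyclic set is the number of members of a presentation that meet it. -/
lemma natRk_eq (hX : M.IsCyclic X) : M.natRk X = (meetingIndices A X).ncard := by
  refine (hA.natRk_le hX.subset_ground).antisymm ?_
  obtain ⟨B, hB⟩ := M.exists_isBasis X hX.subset_ground
  obtain ⟨f, hf, hfA⟩ := (hA B).1 hB.indep
  -- Each e ∈ X lies in a fundamental circuit C of some g. The members meeting C are exactly those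
  -- matched to C \ {g}, so only members matched to B meet X.
  have hsub : meetingIndices A X ⊆ f '' (Subtype.val ⁻¹' B) := by
    rintro i ⟨e, hei, heX⟩
    obtain ⟨g, hgB, C, hC, hgC, hCB, heC, -⟩ := hX.exists_fundCircuit hB heX
    obtain ⟨h1, h2⟩ := hA.circuit hC hgC
    have heq : f '' (Subtype.val ⁻¹' (C \ {g})) = meetingIndices A (C \ {g}) :=
      eq_of_subset_of_ncard_le (image_preimage_val_subset_meetingIndices hfA)
        (by rw [ncard_image_preimage_val hf hCB, h2])
    have hi : i ∈ meetingIndices A C := ⟨e, hei, heC⟩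
    rw [h1, ← heq] at hi
    exact image_mono (preimage_mono hCB) hi
  rw [← hB.ncard_eq_natRk, ← ncard_image_preimage_val hf subset_rfl]
  exact ncard_le_ncard hsub

lemma meetingIndices_closure (hX : M.IsCyclic X) :
    meetingIndices A (M.closure X) = meetingIndices A X := by
  refine (eq_of_subset_of_ncard_le
    (meetingIndices_mono A (M.subset_closure X hX.subset_ground)) ?_).symm
  rw [← hA.natRk_eq hX, ← hA.natRk_eq hX.closure, natRk_closure]

/-- Among the cyclic flats that avoid a given member of a presentation there is a largest one. -/
lemma exists_forall_le_iff (i : ι) :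
    ∃ m : M.CyclicFlats, ∀ Z : M.CyclicFlats, Z ≤ m ↔ i ∉ meetingIndices A Z.1 := by
  -- The union of all cyclic sets avoiding the i-th member is cyclic and avoids it, and passing to
  -- the closure adds no new members.
  have hcyc : M.IsCyclic (⋃₀ {X | M.IsCyclic X ∧ i ∉ meetingIndices A X}) :=
    IsCyclic.sUnion fun X hX => hX.1
  refine ⟨hcyc.toFlat, fun Z => ⟨fun h hi => ?_, fun h => ?_⟩⟩
  · have : i ∈ meetingIndices A (M.closure (⋃₀ {X | M.IsCyclic X ∧ i ∉ meetingIndices A X})) :=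
      meetingIndices_mono A h hi
    rw [hA.meetingIndices_closure hcyc] at this
    obtain ⟨e, hei, X, hX, heX⟩ := this
    exact hX.2 ⟨e, hei, heX⟩
  · have : Z.1 ⊆ ⋃₀ {X | M.IsCyclic X ∧ i ∉ meetingIndices A X} :=
      subset_sUnion_of_mem ⟨Z.isCyclic, h⟩
    exact this.trans (M.subset_closure _ hcyc.subset_ground)

/-- The Mason–Ingleton inequality for a transversal matroid without coloops. -/
lemma finsum_le (hE : M.IsCyclic M.E) {γ : M.CyclicFlats → ℤ}
    (hγ : ∀ Y, ∑ᶠ Z ∈ Ici Y, γ Z = (M.natRk M.E : ℤ) - M.natRk Y.1)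
    {U : Set M.CyclicFlats} (hS : S ⊆ M.E) (hU : ∀ Z ∈ U, S ⊆ Z.1) :
    ∑ᶠ Z ∈ U, γ Z ≤ (M.natRk M.E : ℤ) - M.natRk S := by
  choose m hm using hA.exists_forall_le_iff
  have hcount : ∀ T ⊆ M.E, (({i ∈ meetingIndices A M.E | i ∉ meetingIndices A T}).ncard : ℤ) =
      (M.natRk M.E : ℤ) - (meetingIndices A T).ncard := fun T hT => by
    have := ncard_sdiff_add_ncard_of_subset (meetingIndices_mono A hT)
    rw [hA.natRk_eq hE, ← this]
    push_cast
    exact (add_sub_cancel_right _ _).symm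
  -- γ(Y) counts the members meeting the ground set whose largest avoided cyclic flat is Y: both
  -- sides have the same sums over principal up-sets.
  have heq : γ = fun Y => (({i ∈ meetingIndices A M.E | m i = Y}).ncard : ℤ) := by
    refine eq_of_finsum_mem_Ici_eq fun Y => ?_
    rw [finsum_mem_ncard_fiber, hγ, hA.natRk_eq Y.isCyclic, ← hcount _ Y.2.1.subset_ground]
    simp only [mem_Ici, hm]
  have hle := hA.natRk_le hS
  rw [heq, finsum_mem_ncard_fiber]
  calc (({i ∈ meetingIndices A M.E | m i ∈ U}).ncard : ℤ)
      ≤ ({i ∈ meetingIndices A M.E | i ∉ meetingIndices A S}).ncard := by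
        refine mod_cast ncard_le_ncard fun i hi => ⟨hi.1, fun hiS => ?_⟩
        exact (hm i (m i)).1 le_rfl (meetingIndices_mono A (hU _ hi.2) hiS)
    _ = (M.natRk M.E : ℤ) - (meetingIndices A S).ncard := hcount S hS
    _ ≤ _ := by omega

end IsPresentation

/-- The converse of the Mason–Ingleton inequality: it suffices for transversality. -/
lemma isTransversal_of_finsum_le [M.Finite] {γ : M.CyclicFlats → ℤ}
    (hγ : ∀ Y, ∑ᶠ Z ∈ Ici Y, γ Z = (M.natRk M.E : ℤ) - M.natRk Y.1)
    (hMI : ∀ (U : Set M.CyclicFlats) (S : Set α), IsUpperSet U → S ⊆ M.E → (∀ Z ∈ U, S ⊆ Z.1) →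
      ∑ᶠ Z ∈ U, γ Z ≤ (M.natRk M.E : ℤ) - M.natRk S) : M.IsTransversal := by
  -- Apply the inequality to the flats strictly above Z, with S = Z.
  have hpos : ∀ Z, 0 ≤ γ Z := fun Z => by
    have h1 := hMI (Ioi Z) Z.1 (isUpperSet_Ioi Z) Z.2.1.subset_ground fun Y hY => hY.le
    have h2 := finsum_mem_Ici_eq_add γ Z
    rw [hγ] at h2
    omega
  -- The presentation takes the complement of each cyclic flat Z with multiplicity γ(Z).
  let κ := Σ Z : M.CyclicFlats, Fin (γ Z).toNat
  let A : κ → Set α := fun p => M.E \ p.1.1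
  have hfib : ∀ U : Set M.CyclicFlats, (({p : κ | p.1 ∈ U}).ncard : ℤ) = ∑ᶠ Z ∈ U, γ Z := by
    intro U
    have h := finsum_mem_ncard_fiber (fun p : κ => p.1) univ U
    simp only [mem_univ, true_and] at h
    rw [← h]
    refine finsum_mem_congr rfl fun Z _ => ?_
    have : {p : κ | p.1 = Z} = range (Sigma.mk Z) := by
      ext ⟨Y, k⟩
      constructor
      · rintro rfl; exact ⟨k, rfl⟩
      · rintro ⟨k', h⟩; exact (congrArg Sigma.fst h).symm
    rw [this, ← image_univ, ncard_image_of_injective _ sigma_mk_injective, ncard_univ, Nat.card_fin,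
      Int.toNat_of_nonneg (hpos Z)]
  have hmeet : ∀ S ⊆ M.E, ((meetingIndices A S).ncard : ℤ) =
      M.natRk M.E - ∑ᶠ Z ∈ {Z : M.CyclicFlats | S ⊆ Z.1}, γ Z := fun S hS => by
    have h0 : ∑ᶠ Z ∈ univ, γ Z = M.natRk M.E := by
      have := hγ (isCyclic_empty M).toFlat
      have hIci : Ici (isCyclic_empty M).toFlat = univ :=
        eq_univ_of_forall fun Z => (isCyclic_empty M).toFlat_le_iff.2 (empty_subset _)
      rw [hIci] at this
      rw [this]
      change (M.natRk M.E : ℤ) - (M.natRk (M.closure ∅) : ℕ) = _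
      simp [natRk]
    have h1 : meetingIndices A S = {p : κ | p.1 ∈ {Z : M.CyclicFlats | S ⊆ Z.1}}ᶜ := by
      ext p
      simp only [meetingIndices, A, Set.Nonempty, mem_ofPred_eq, mem_compl_iff, not_subset]
      exact exists_congr fun e => ⟨fun h => ⟨h.2, h.1.2⟩, fun h => ⟨⟨hS h.1, h.2⟩, h.1⟩⟩
    have h2 := ncard_add_ncard_compl {p : κ | p.1 ∈ {Z : M.CyclicFlats | S ⊆ Z.1}}
    have h3 := hfib univ
    rw [show {p : κ | p.1 ∈ univ} = univ from eq_univ_of_forall fun _ => mem_univ _,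
      ncard_univ] at h3
    rw [← hfib, h1, ← h0, ← h3, ← h2]
    push_cast
    ring
  have hpres : M.IsPresentation A := by
    intro I
    constructor
    · intro hI
      refine isPartialTransversal_of_forall_ncard_le fun S hS _ => ?_
      have hSE := hS.trans hI.subset_ground
      have h1 := hMI {Z | S ⊆ Z.1} S (fun Y Z hYZ (hY : S ⊆ Y.1) => Subset.trans hY hYZ) hSE fun Z hZ => hZ
      have h2 := hmeet S hSE
      rw [(hI.subset hS).ncard_eq_natRk]
      omega
    · intro hI
      by_contra hdep
      have hIE : I ⊆ M.E := fun e he => by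
        obtain ⟨f, -, hfA⟩ := hI
        exact (hfA ⟨e, he⟩).1
      obtain ⟨C, hCI, hC⟩ := ((not_indep_iff hIE).1 hdep).exists_isCircuit_subset
      have h1 := hI.ncard_le hCI
      -- The closure of C is a cyclic flat, so it meets exactly r(C) = |C| - 1 members, too few to
      -- match C.
      have h2 := ncard_le_ncard (meetingIndices_mono A (M.subset_closure C hC.subset_ground))
      have h3 := hmeet _ (M.closure_subset_ground C)
      have h4 : {Z : M.CyclicFlats | M.closure C ⊆ Z.1} = Ici hC.isCyclic.toFlat := rfl
      rw [h4, hγ] at h3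
      change _ = (_ : ℤ) - ((_ : ℤ) - (M.natRk (M.closure C) : ℕ)) at h3
      have h5 := hC.natRk_add_one
      rw [natRk_closure] at h3
      omega
  refine ⟨Nat.card κ, A ∘ (Finite.equivFin κ).symm, fun i => sdiff_subset, fun I => ?_⟩
  rw [hpres I]
  constructor
  · rintro ⟨f, hf, hfA⟩
    exact ⟨Finite.equivFin κ ∘ f, (Equiv.injective _).comp hf, by simpa using hfA⟩
  · rintro ⟨f, hf, hfA⟩
    exact ⟨(Finite.equivFin κ).symm ∘ f, (Equiv.injective _).comp hf, hfA⟩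

end Matroid

namespace Matroid

variable {α : Type*} {M : Matroid α}

/-! ### The minor between two nested cyclic flats -/

/-- Extend a basis of A to one of X ∪ A; the part outside A is a basis in the contraction. The
additive form avoids truncated subtraction. -/
lemma natRk_contract_add {X A : Set α} [M.Finite] (hX : X ⊆ M.E) (hA : A ⊆ M.E) :
    (M ／ A).natRk (X \ A) + M.natRk A = M.natRk (X ∪ A) := by
  obtain ⟨J, hJ⟩ := M.exists_isBasis A
  obtain ⟨I, hI, hJI⟩ := hJ.indep.subset_isBasis_of_subset
    (hJ.subset.trans (subset_union_right (s := X))) (union_subset hX hA)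
  have hIA : I ∩ A = J := (hJ.eq_of_subset_indep (hI.indep.subset inter_subset_left)
    (subset_inter hJI hJ.subset) inter_subset_right).symm
  have h := hI.contract_isBasis hJ (hI.indep.subset (union_subset sdiff_subset hJI))
  rw [union_sdiff_right] at h
  rw [← h.ncard_eq_natRk, ← hJ.ncard_eq_natRk, ← hI.ncard_eq_natRk, ← hIA, add_comm]
  exact ncard_inter_add_ncard_sdiff_eq_ncard I A (finite_of_subset_ground hI.indep.subset_ground)

section Interval

variable {A B : M.CyclicFlats}

lemma natRk_interval_add [M.Finite] (hAB : A ≤ B) {X : Set α} (hX : X ⊆ B.1) :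
    ((M ↾ B.1) ／ A.1).natRk (X \ A.1) + M.natRk A.1 = M.natRk (X ∪ A.1) := by
  have : (M ↾ B.1).Finite := ⟨finite_of_subset_ground B.2.1.subset_ground⟩
  have h := natRk_contract_add (M := M ↾ B.1) hX hAB
  have hr : ∀ Y ⊆ B.1, (M ↾ B.1).natRk Y = M.natRk Y := fun Y hY => by
    rw [natRk, restrict_eRk_eq _ hY, natRk]
  rwa [hr _ hAB, hr _ (union_subset hX hAB)] at h

lemma interval_closure (hAB : A ≤ B) {X : Set α} (hX : X ⊆ B.1) :
    ((M ↾ B.1) ／ A.1).closure X = M.closure (X ∪ A.1) \ A.1 := by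
  have hXA : X ∪ A.1 ⊆ B.1 := union_subset hX hAB
  have hcl : M.closure (X ∪ A.1) ⊆ B.1 := B.closure_eq ▸ M.closure_subset_closure hXA
  rw [contract_closure_eq, restrict_closure_eq _ hXA B.2.1.subset_ground,
    inter_eq_self_of_subset_left hcl]

/-- Closure in the minor is closure in M after adjoining A, with A then removed. Elements of A are
never coloops of Y because A is itself cyclic. -/
lemma interval_isCyclicFlat_iff (hAB : A ≤ B) {Y : Set α} (hAY : A.1 ⊆ Y) (hYB : Y ⊆ B.1) :
    ((M ↾ B.1) ／ A.1).IsCyclicFlat (Y \ A.1) ↔ M.IsCyclicFlat Y := by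
  have hYE := hYB.trans B.2.1.subset_ground
  rw [isCyclicFlat_iff, isCyclicFlat_iff, isFlat_iff_closure_eq, isFlat_iff_closure_eq,
    interval_closure hAB (sdiff_subset.trans hYB), sdiff_union_of_subset hAY]
  refine and_congr ⟨fun h => ?_, fun h => by rw [h]⟩ ⟨fun h e he => ?_, fun h e he => ?_⟩
  · rw [← sdiff_union_of_subset (hAY.trans (M.subset_closure Y hYE)), h,
      sdiff_union_of_subset hAY]
  · by_cases heA : e ∈ A.1
    · exact M.closure_subset_closure (sdiff_subset_sdiff_left hAY) (A.isCyclic e heA)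
    · have := h e ⟨he, heA⟩
      rw [interval_closure hAB (sdiff_subset.trans (sdiff_subset.trans hYB))] at this
      refine M.closure_subset_closure (union_subset ?_ (subset_sdiff_singleton hAY heA)) this.1
      exact sdiff_subset_sdiff_left sdiff_subset
  · rw [interval_closure hAB (sdiff_subset.trans (sdiff_subset.trans hYB))]
    refine ⟨M.closure_subset_closure ?_ (h e he.1), he.2⟩
    intro f hf
    by_cases hfA : f ∈ A.1
    · exact Or.inr hfA
    · exact Or.inl ⟨⟨hf.1, hfA⟩, hf.2⟩

/-- The cyclic flats of the minor `(M ↾ B) ／ A` correspond to those of `M` between `A`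
and `B`. -/
def intervalIso (hAB : A ≤ B) : ((M ↾ B.1) ／ A.1).CyclicFlats ≃o Icc A B where
  toFun X :=
    have hXB : X.1 ⊆ B.1 \ A.1 := X.2.1.subset_ground
    ⟨⟨X.1 ∪ A.1, (interval_isCyclicFlat_iff hAB subset_union_right
        (union_subset (hXB.trans sdiff_subset) hAB)).1 (by
        rw [union_sdiff_right, (disjoint_sdiff_left.mono_left hXB).sdiff_eq_left]; exact X.2)⟩,
      subset_union_right, union_subset (hXB.trans sdiff_subset) hAB⟩
  invFun Y := ⟨Y.1.1 \ A.1, (interval_isCyclicFlat_iff hAB Y.2.1 Y.2.2).2 Y.1.2⟩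
  left_inv X := by
    have hXB : X.1 ⊆ B.1 \ A.1 := X.2.1.subset_ground
    refine Subtype.ext ?_
    change (X.1 ∪ A.1) \ A.1 = X.1
    rw [union_sdiff_right, (disjoint_sdiff_left.mono_left hXB).sdiff_eq_left]
  right_inv Y := Subtype.ext (Subtype.ext (sdiff_union_of_subset Y.2.1))
  map_rel_iff' {X Y} := by
    have hXB : X.1 ⊆ B.1 \ A.1 := X.2.1.subset_ground
    change X.1 ∪ A.1 ⊆ Y.1 ∪ A.1 ↔ X.1 ⊆ Y.1
    refine ⟨fun h e he => ?_, fun h => union_subset_union_left _ h⟩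
    exact (h (Or.inl he)).resolve_right (hXB he).2

lemma coe_intervalIso (hAB : A ≤ B) (X : ((M ↾ B.1) ／ A.1).CyclicFlats) :
    (intervalIso hAB X).1.1 = X.1 ∪ A.1 := rfl

/-- The Mason–Ingleton inequality holds for an up-set generated inside an interval of cyclic
flats if the corresponding minor is transversal. -/
lemma finsum_le_of_interval [M.Finite] (hAB : A ≤ B) (hN : ((M ↾ B.1) ／ A.1).IsTransversal)
    (hcomp : ∀ Z, A ≤ Z → Z ≤ B ∨ B ≤ Z) {γ : M.CyclicFlats → ℤ}
    (hγ : ∀ Y, ∑ᶠ Z ∈ Ici Y, γ Z = (M.natRk M.E : ℤ) - M.natRk Y.1)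
    {U : Set M.CyclicFlats} (hU : IsUpperSet U) (hUA : ∀ Z ∈ U, A ≤ Z) (hBU : B ∈ U)
    {S : Set α} (hS : ∀ Z ∈ U, S ⊆ Z.1) :
    ∑ᶠ Z ∈ U, γ Z ≤ (M.natRk M.E : ℤ) - M.natRk S := by
  classical
  have : (M ↾ B.1).Finite := ⟨finite_of_subset_ground B.2.1.subset_ground⟩
  let e := intervalIso hAB
  -- δ is the γ-function of the minor: its top flat has full rank, hence value 0. The total of γ
  -- over `Ici B` is the constant r(M) - r(B), split off in `hsplit`.
  let δ : M.CyclicFlats → ℤ := fun Z => if Z = B then 0 else γ Z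
  have hsplit : ∀ V : Set M.CyclicFlats, IsUpperSet V → (∀ Z ∈ V, A ≤ Z) → B ∈ V →
      ∑ᶠ Z ∈ V, γ Z = ∑ᶠ X ∈ {X | (e X).1 ∈ V}, δ (e X).1 +
        ((M.natRk M.E : ℤ) - M.natRk B.1) := by
    intro V hV hVA hBV
    have h1 : V = (V ∩ Iio B) ∪ Ici B := by
      ext Z
      refine ⟨fun hZ => ?_, ?_⟩
      · rcases hcomp Z (hVA Z hZ) with h | h
        · rcases h.lt_or_eq with h | h
          · exact Or.inl ⟨hZ, h⟩
          · exact Or.inr h.ge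
        · exact Or.inr h
      · rintro (h | h)
        · exact h.1
        · exact hV h hBV
    have hdis : Disjoint (V ∩ Iio B) (Ici B) :=
      disjoint_left.2 fun Z hZ hZ' => not_le_of_gt (mem_Iio.1 hZ.2) (mem_Ici.1 hZ')
    have h2 : ∑ᶠ X ∈ {X | (e X).1 ∈ V}, δ (e X).1 = ∑ᶠ Z ∈ insert B (V ∩ Iio B), δ Z := by
      refine finsum_mem_eq_of_bijOn (fun X => (e X).1) ⟨fun X hX => ?_, ?_, ?_⟩ fun X _ => rfl
      · rcases (e X).2.2.lt_or_eq with h | h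
        · exact Or.inr ⟨hX, h⟩
        · exact Or.inl h
      · exact fun X _ Y _ h => e.injective (Subtype.ext h)
      · intro Z hZ
        have hZ' : Z ∈ V ∧ Z ≤ B := by
          rcases hZ with rfl | h
          · exact ⟨hBV, le_rfl⟩
          · exact ⟨h.1, (mem_Iio.1 h.2).le⟩
        refine ⟨e.symm ⟨Z, hVA Z hZ'.1, hZ'.2⟩, ?_, ?_⟩
        · change (e (e.symm _)).1 ∈ V
          rw [e.apply_symm_apply]
          exact hZ'.1
        · change (e (e.symm _)).1 = Z
          rw [e.apply_symm_apply]
    rw [h2, finsum_mem_insert _ (by simp) (Set.toFinite _), h1,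
      finsum_mem_union hdis (Set.toFinite _) (Set.toFinite _), hγ, ← h1]
    have h3 : ∑ᶠ Z ∈ V ∩ Iio B, δ Z = ∑ᶠ Z ∈ V ∩ Iio B, γ Z :=
      finsum_mem_congr rfl fun Z hZ => if_neg (mem_Iio.1 hZ.2).ne
    rw [h3, show δ B = 0 from if_pos rfl, zero_add]
  have hE : ((M ↾ B.1) ／ A.1).E = B.1 \ A.1 := rfl
  have hrE := natRk_interval_add hAB (subset_refl B.1)
  rw [union_eq_self_of_subset_right (show A.1 ⊆ B.1 from hAB)] at hrE
  have hδ : ∀ Y, ∑ᶠ X ∈ Ici Y, δ (e X).1 = (((M ↾ B.1) ／ A.1).natRk ((M ↾ B.1) ／ A.1).E : ℤ) -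
      ((M ↾ B.1) ／ A.1).natRk Y.1 := by
    intro Y
    have hYB : Y.1 ⊆ B.1 \ A.1 := Y.2.1.subset_ground
    have h1 := hsplit (Ici (e Y).1) (isUpperSet_Ici _) (fun Z hZ => (e Y).2.1.trans hZ) (e Y).2.2
    have h2 : {X | (e X).1 ∈ Ici (e Y).1} = Ici Y := by
      ext X
      exact e.le_iff_le
    have h3 := natRk_interval_add hAB (hYB.trans sdiff_subset)
    rw [(disjoint_sdiff_left.mono_left hYB).sdiff_eq_left] at h3
    rw [hγ, h2, coe_intervalIso] at h1
    rw [hE]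
    omega
  have hSB := hS B hBU
  have hrS := natRk_interval_add hAB hSB
  have hmono := M.natRk_mono (subset_union_left (s := S) (t := A.1))
  obtain ⟨m, P, -, hP⟩ := hN
  have hcyc : ((M ↾ B.1) ／ A.1).IsCyclic ((M ↾ B.1) ／ A.1).E :=
    (isCyclicFlat_iff.1 ((interval_isCyclicFlat_iff hAB hAB subset_rfl).2 B.2)).2
  have hle := IsPresentation.finsum_le hP hcyc hδ (U := {X | (e X).1 ∈ U})
    (S := S \ A.1) (sdiff_subset_sdiff_left hSB) (fun X hX => ?_)
  · rw [hsplit U hU hUA hBU]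
    rw [hE] at hle
    omega
  · intro f hf
    exact (hS _ hX hf.1).resolve_right hf.2

end Interval

end Matroid

/-! ### Ordered sets of width at most two -/

/-- The minimal elements of U form an antichain, so there are at most two; x = y covers the case of
a single one. -/
lemma exists_pair_of_orderWidth_le_two {L : Type*} [PartialOrder L] [Finite L]
    (hwidth : orderWidth L ≤ 2) {U : Set L} (hU : U.Nonempty) :
    ∃ x ∈ U, ∃ y ∈ U, (∀ w ∈ U, x ≤ w ∨ y ≤ w) ∧ (x ≤ y → x = y) ∧ (y ≤ x → x = y) := by
  have hmin : ∀ w ∈ U, ∃ z, Minimal (· ∈ U) z ∧ z ≤ w := fun w hw => by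
    obtain ⟨z, hzw, hz⟩ := exists_minimal_le_of_wellFoundedLT (· ∈ U) w hw
    exact ⟨z, hz, hzw⟩
  obtain ⟨w, hw⟩ := hU
  obtain ⟨x, hx, -⟩ := hmin w hw
  by_cases hall : ∀ w ∈ U, x ≤ w
  · exact ⟨x, hx.prop, x, hx.prop, fun w hw => Or.inl (hall w hw), fun _ => rfl, fun _ => rfl⟩
  push Not at hall
  obtain ⟨v, hv, hxv⟩ := hall
  obtain ⟨y, hy, hyv⟩ := hmin v hv
  have hxy : x ≠ y := fun h => hxv (h ▸ hyv)
  refine ⟨x, hx.prop, y, hy.prop, fun w hw => ?_, fun h => hy.eq_of_le hx.prop h,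
    fun h => (hx.eq_of_le hy.prop h).symm⟩
  by_contra! hcon
  obtain ⟨z, hz, hzw⟩ := hmin w hw
  have hxz : x ≠ z := fun h => hcon.1 (h ▸ hzw)
  have hyz : y ≠ z := fun h => hcon.2 (h ▸ hzw)
  have hanti : IsAntichain (· ≤ ·) ({x, y, z} : Set L) := by
    refine (setOfPred_minimal_antichain (· ∈ U)).subset ?_
    rintro _ (rfl | rfl | rfl)
    exacts [hx, hy, hz]
  have h := (le_iSup₂ (f := fun (A : Set L) (_ : IsAntichain (· ≤ ·) A) => A.encard) _ hanti).trans
    hwidth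
  rw [encard_eq_three.2 ⟨x, y, z, hxy, hxz, hyz, rfl⟩] at h
  exact absurd h (by decide)

/-! ### Transversality from the fibres -/

namespace Matroid

/-- Transversality of a matroid whose lattice of cyclic flats is fibred, lexicographically, over
an ordered set of width at most two with joins, if the fibres give transversal minors. -/
theorem isTransversal_of_fibers {α L : Type*} {M : Matroid α} [M.Finite] [PartialOrder L]
    [Finite L] (hjoin : ∀ x y : L, ∃ z, IsLUB {x, y} z) (hwidth : orderWidth L ≤ 2)
    {p : M.CyclicFlats → L} {b t : L → M.CyclicFlats} (hp : Monotone p)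
    (hlt : ∀ Y Z, p Y < p Z → Y ≤ Z) (hpb : ∀ x, p (b x) = x) (hpt : ∀ x, p (t x) = x)
    (hb : ∀ Z, b (p Z) ≤ Z) (ht : ∀ Z, Z ≤ t (p Z))
    (hN : ∀ x, ((M ↾ (t x).1) ／ (b x).1).IsTransversal) : M.IsTransversal := by
  have hble : ∀ {x Z}, b x ≤ Z ↔ x ≤ p Z := by
    refine fun {x Z} => ⟨fun h => hpb x ▸ hp h, fun h => ?_⟩
    rcases h.eq_or_lt with rfl | h
    · exact hb Z
    · exact hlt _ _ (by rwa [hpb])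
  obtain ⟨γ, hγ⟩ := exists_finsum_mem_Ici_eq
    fun Z : M.CyclicFlats => (M.natRk M.E : ℤ) - M.natRk Z.1
  -- The case of a least index x: a flat above `b x` is either in the fibre over x or above `t x`.
  have hone : ∀ (x : L) (U : Set M.CyclicFlats) (S : Set α), IsUpperSet U →
      (∀ Z ∈ U, x ≤ p Z) → (∃ Z ∈ U, p Z = x) → (∀ Z ∈ U, S ⊆ Z.1) →
      ∑ᶠ Z ∈ U, γ Z ≤ (M.natRk M.E : ℤ) - M.natRk S := by
    rintro x U S hU hxU ⟨Z, hZ, rfl⟩ hS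
    refine finsum_le_of_interval ((hb Z).trans (ht Z)) (hN (p Z)) (fun Y hY => ?_) hγ hU
      (fun Y hY => hble.2 (hxU Y hY)) (hU (ht Z) hZ) hS
    rcases (hble.1 hY).eq_or_lt with h | h
    · exact Or.inl (h ▸ ht Y)
    · exact Or.inr (hlt _ _ (by rwa [hpt]))
  refine isTransversal_of_finsum_le hγ fun U S hU hSE hS => ?_
  obtain rfl | hne := U.eq_empty_or_nonempty
  · have := M.natRk_mono hSE
    rw [finsum_mem_empty]
    omega
  obtain ⟨x, ⟨X, hX, rfl⟩, y, ⟨Y, hY, rfl⟩, hxy, hx, hy⟩ :=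
    exists_pair_of_orderWidth_le_two hwidth (hne.image p)
  by_cases hcomp : p X = p Y
  · refine hone (p X) U S hU (fun Z hZ => ?_) ⟨X, hX, rfl⟩ hS
    rcases hxy (p Z) (mem_image_of_mem p hZ) with h | h
    · exact h
    · exact hcomp ▸ h
  obtain ⟨j, hj⟩ := hjoin (p X) (p Y)
  have hXj : p X ≤ j := hj.1 (by simp)
  have hYj : p Y ≤ j := hj.1 (by simp)
  have hXj' : p X < j := hXj.lt_of_ne fun h => hcomp (hy (h ▸ hYj))
  let UX : Set M.CyclicFlats := {Z ∈ U | p X ≤ p Z}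
  let UY : Set M.CyclicFlats := {Z ∈ U | p Y ≤ p Z}
  have hup : ∀ x, IsUpperSet {Z ∈ U | x ≤ p Z} := fun x Z Z' h hZ =>
    ⟨hU h hZ.1, hZ.2.trans (hp h)⟩
  have hunion : UX ∪ UY = U := by
    ext Z
    refine ⟨fun h => h.elim And.left And.left, fun h => ?_⟩
    exact (hxy (p Z) (mem_image_of_mem p h)).imp (fun h' => ⟨h, h'⟩) fun h' => ⟨h, h'⟩
  -- Since j is strictly above `p X`, every flat of index at least j lies above X and hence in U.
  have hinter : UX ∩ UY = Ici (b j) := by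
    ext Z
    refine ⟨fun h => hble.2 (hj.2 ?_), fun h => ?_⟩
    · rintro _ (rfl | rfl)
      exacts [h.1.2, h.2.2]
    · have hjZ := hble.1 h
      have hZ := hU (hlt X Z (hXj'.trans_le hjZ)) hX
      exact ⟨⟨hZ, hXj.trans hjZ⟩, ⟨hZ, hYj.trans hjZ⟩⟩
  let PX : Set α := ⋂ Z ∈ UX, Z.1
  let PY : Set α := ⋂ Z ∈ UY, Z.1
  have hPX : ∀ Z ∈ UX, PX ⊆ Z.1 := fun Z hZ => biInter_subset_of_mem hZ
  have hPY : ∀ Z ∈ UY, PY ⊆ Z.1 := fun Z hZ => biInter_subset_of_mem hZ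
  have h1 := hone (p X) UX PX (hup _) (fun Z hZ => hZ.2) ⟨X, ⟨hX, le_rfl⟩, rfl⟩ hPX
  have h2 := hone (p Y) UY PY (hup _) (fun Z hZ => hZ.2) ⟨Y, ⟨hY, le_rfl⟩, rfl⟩ hPY
  have h3 := finsum_mem_union_inter (f := γ) UX.toFinite UY.toFinite
  rw [hunion, hinter, hγ] at h3
  have h4 := M.natRk_inter_add_natRk_union_le PX PY
  have h5 : M.natRk S ≤ M.natRk (PX ∩ PY) := M.natRk_mono (subset_inter
    (subset_iInter₂ fun Z hZ => hS Z hZ.1) (subset_iInter₂ fun Z hZ => hS Z hZ.1))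
  -- PX and PY contain the bottoms of their fibres. The closure of the union of these bottoms is a
  -- cyclic flat of index at least j, so it contains `b j`.
  have h6 : M.natRk (b j).1 ≤ M.natRk (PX ∪ PY) := by
    have hcyc := (b (p X)).isCyclic.union (b (p Y)).isCyclic
    have hle : b j ≤ hcyc.toFlat := by
      refine hble.2 (hj.2 ?_)
      have hsub := hcyc.toFlat_le_iff.1 le_rfl
      rintro _ (rfl | rfl)
      · exact hble.1 (subset_union_left.trans hsub)
      · exact hble.1 (subset_union_right.trans hsub)
    calc M.natRk (b j).1 ≤ M.natRk hcyc.toFlat.1 := M.natRk_mono hle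
      _ = M.natRk ((b (p X)).1 ∪ (b (p Y)).1) := M.natRk_closure _
      _ ≤ _ := M.natRk_mono (union_subset_union
        (subset_iInter₂ fun Z hZ => hble.2 hZ.2) (subset_iInter₂ fun Z hZ => hble.2 hZ.2))
  omega

end Matroid

/-! ### Lexicographic sums of finite lattices -/

namespace IsFiniteLattice

variable {P : Type*} [PartialOrder P] (hP : IsFiniteLattice P)
include hP

lemma exists_isBot : ∃ b : P, IsBot b := by
  have := hP.finite
  have := hP.nonempty
  have : IsCodirectedOrder P := ⟨fun x y =>
    (hP.exists_meet x y).imp fun z hz => ⟨hz.1 (by simp), hz.1 (by simp)⟩⟩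
  obtain ⟨b, hb⟩ := (Set.finite_univ (α := P)).bddBelow
  exact ⟨b, fun x => hb (mem_univ x)⟩

lemma exists_isTop : ∃ t : P, IsTop t := by
  have := hP.finite
  have := hP.nonempty
  have : IsDirectedOrder P := ⟨fun x y =>
    (hP.exists_join x y).imp fun z hz => ⟨hz.1 (by simp), hz.1 (by simp)⟩⟩
  obtain ⟨t, ht⟩ := (Set.finite_univ (α := P)).bddAbove
  exact ⟨t, fun x => ht (mem_univ x)⟩

end IsFiniteLattice

lemma isLUB_pair_of_forall {P : Type*} [Preorder P] {p q r : P} (hp : p ≤ r) (hq : q ≤ r)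
    (h : ∀ s, p ≤ s → q ≤ s → r ≤ s) : IsLUB {p, q} r :=
  ⟨by rintro _ (rfl | rfl) <;> assumption, fun s hs => h s (hs (by simp)) (hs (by simp))⟩

lemma isGLB_pair_of_forall {P : Type*} [Preorder P] {p q r : P} (hp : r ≤ p) (hq : r ≤ q)
    (h : ∀ s, s ≤ p → s ≤ q → s ≤ r) : IsGLB {p, q} r :=
  ⟨by rintro _ (rfl | rfl) <;> assumption, fun s hs => h s (hs (by simp)) (hs (by simp))⟩

namespace LexSum

section

variable {L : Type*} {F : L → Type*}

/-- The element of the lexicographic sum over `x` given by `a : F x`. -/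
def mk (x : L) (a : F x) : LexSum F := toLex ⟨x, a⟩

/-- The index of an element of the lexicographic sum. -/
def index (p : LexSum F) : L := (ofLex p).1

@[simp] lemma index_mk (x : L) (a : F x) : index (mk x a) = x := rfl

end

variable {L : Type*} [PartialOrder L] {F : L → Type*} [∀ x, PartialOrder (F x)]

lemma mk_le_mk_of_lt {x y : L} (h : x < y) (a : F x) (b : F y) : mk x a ≤ mk y b :=
  Sigma.Lex.left _ _ h

lemma mk_le_mk_iff {x : L} {a b : F x} : mk x a ≤ mk x b ↔ a ≤ b := by
  refine ⟨fun h => ?_, fun h => Sigma.Lex.right _ _ h⟩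
  rcases Sigma.Lex.le_def.1 h with h | ⟨_, h⟩
  · exact absurd h (lt_irrefl x)
  · exact h

lemma index_mono : Monotone (index (F := F)) := fun p q h => by
  rcases Sigma.Lex.le_def.1 h with h | ⟨h, _⟩
  · exact le_of_lt h
  · exact le_of_eq h

lemma le_of_index_lt {p q : LexSum F} (h : index p < index q) : p ≤ q :=
  mk_le_mk_of_lt h (ofLex p).2 (ofLex q).2

lemma mk_le_iff_of_isBot {x : L} {b : F x} (hb : IsBot b) {p : LexSum F} :
    mk x b ≤ p ↔ x ≤ index p := by
  refine ⟨fun h => index_mono h, fun h => ?_⟩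
  rcases h.eq_or_lt with rfl | h
  · exact mk_le_mk_iff.2 (hb (ofLex p).2)
  · exact le_of_index_lt h

lemma le_mk_iff_of_isTop {x : L} {t : F x} (ht : IsTop t) {p : LexSum F} :
    p ≤ mk x t ↔ index p ≤ x := by
  refine ⟨fun h => index_mono h, fun h => ?_⟩
  rcases h.eq_or_lt with rfl | h
  · exact mk_le_mk_iff.2 (ht (ofLex p).2)
  · exact le_of_index_lt h

/-- Incomparable elements with different indices have incomparable indices, so the join of the
indices is strictly above both and the bottom of its fibre is the join; dually for meets. With equal
indices, both are taken in the fibre. -/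
theorem isFiniteLattice (hL : IsFiniteLattice L) (hF : ∀ x, IsFiniteLattice (F x)) :
    IsFiniteLattice (LexSum F) where
  finite := by
    have := hL.finite
    have := fun x => (hF x).finite
    exact inferInstanceAs (Finite (Sigma F))
  nonempty := by
    obtain ⟨x⟩ := hL.nonempty
    obtain ⟨a⟩ := (hF x).nonempty
    exact ⟨mk x a⟩
  exists_join p q := by
    by_cases hpq : p ≤ q
    · exact ⟨q, isLUB_pair_of_forall hpq le_rfl fun _ _ h => h⟩
    by_cases hqp : q ≤ p
    · exact ⟨p, isLUB_pair_of_forall le_rfl hqp fun _ h _ => h⟩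
    obtain ⟨x, a⟩ := p
    obtain ⟨y, b⟩ := q
    by_cases hxy : x = y
    · subst hxy
      obtain ⟨c, hc⟩ := (hF x).exists_join a b
      refine ⟨mk x c, isLUB_pair_of_forall (mk_le_mk_iff.2 (hc.1 (by simp)))
        (mk_le_mk_iff.2 (hc.1 (by simp))) ?_⟩
      rintro ⟨z, d⟩ ha hb
      rcases (index_mono ha).eq_or_lt with h | h
      · obtain rfl : x = z := h
        refine mk_le_mk_iff.2 (hc.2 ?_)
        rintro _ (rfl | rfl)
        exacts [mk_le_mk_iff.1 ha, mk_le_mk_iff.1 hb]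
      · exact mk_le_mk_of_lt h _ _
    · obtain ⟨z, hz⟩ := hL.exists_join x y
      have hxz : x ≤ z := hz.1 (by simp)
      have hyz : y ≤ z := hz.1 (by simp)
      obtain ⟨c, hc⟩ := (hF z).exists_isBot
      refine ⟨mk z c, isLUB_pair_of_forall
        (mk_le_mk_of_lt (hxz.lt_of_ne ?_) _ _) (mk_le_mk_of_lt (hyz.lt_of_ne ?_) _ _) ?_⟩
      · rintro rfl
        exact hqp (mk_le_mk_of_lt (hyz.lt_of_ne (Ne.symm hxy)) _ _)
      · rintro rfl
        exact hpq (mk_le_mk_of_lt (hxz.lt_of_ne hxy) _ _)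
      · intro s hs hs'
        refine (mk_le_iff_of_isBot hc).2 (hz.2 ?_)
        rintro _ (rfl | rfl)
        exacts [index_mono hs, index_mono hs']
  exists_meet p q := by
    by_cases hpq : p ≤ q
    · exact ⟨p, isGLB_pair_of_forall le_rfl hpq fun _ h _ => h⟩
    by_cases hqp : q ≤ p
    · exact ⟨q, isGLB_pair_of_forall hqp le_rfl fun _ _ h => h⟩
    obtain ⟨x, a⟩ := p
    obtain ⟨y, b⟩ := q
    by_cases hxy : x = y
    · subst hxy
      obtain ⟨c, hc⟩ := (hF x).exists_meet a b
      refine ⟨mk x c, isGLB_pair_of_forall (mk_le_mk_iff.2 (hc.1 (by simp)))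
        (mk_le_mk_iff.2 (hc.1 (by simp))) ?_⟩
      rintro ⟨z, d⟩ ha hb
      rcases (index_mono ha).eq_or_lt with h | h
      · obtain rfl : z = x := h
        refine mk_le_mk_iff.2 (hc.2 ?_)
        rintro _ (rfl | rfl)
        exacts [mk_le_mk_iff.1 ha, mk_le_mk_iff.1 hb]
      · exact mk_le_mk_of_lt h _ _
    · obtain ⟨z, hz⟩ := hL.exists_meet x y
      have hxz : z ≤ x := hz.1 (by simp)
      have hyz : z ≤ y := hz.1 (by simp)
      obtain ⟨c, hc⟩ := (hF z).exists_isTop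
      refine ⟨mk z c, isGLB_pair_of_forall
        (mk_le_mk_of_lt (hxz.lt_of_ne ?_) _ _) (mk_le_mk_of_lt (hyz.lt_of_ne ?_) _ _) ?_⟩
      · rintro rfl
        exact hpq (mk_le_mk_of_lt (hyz.lt_of_ne hxy) _ _)
      · rintro rfl
        exact hqp (mk_le_mk_of_lt (hxz.lt_of_ne (Ne.symm hxy)) _ _)
      · intro s hs hs'
        refine (le_mk_iff_of_isTop hc).2 (hz.2 ?_)
        rintro _ (rfl | rfl)
        exacts [index_mono hs, index_mono hs']

/-- In an ordered set isomorphic to a lexicographic sum, the interval over an index `x` is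
isomorphic to the summand `F x`. -/
noncomputable def fiberIso {Q : Type*} [Preorder Q] (e : LexSum F ≃o Q) {x : L} {b t : F x}
    (hb : IsBot b) (ht : IsTop t) : F x ≃o Icc (e (mk x b)) (e (mk x t)) :=
  RelIso.ofSurjective
    (OrderEmbedding.ofMapLEIff (fun a => (⟨e (mk x a), e.monotone (mk_le_mk_iff.2 (hb a)),
      e.monotone (mk_le_mk_iff.2 (ht a))⟩ : Icc (e (mk x b)) (e (mk x t))))
      fun _ _ => e.le_iff_le.trans mk_le_mk_iff) fun q => by
    obtain ⟨q, h1, h2⟩ := q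
    obtain ⟨⟨y, a⟩, rfl⟩ := e.surjective q
    obtain rfl : x = y :=
      le_antisymm (index_mono (e.le_iff_le.1 h1)) (index_mono (e.le_iff_le.1 h2))
    exact ⟨a, rfl⟩

end LexSum

/-! ### Lexicographic sums of Tr-lattices -/

theorem mainTheorem5 (L : Type u) [PartialOrder L] (hL : IsFiniteLattice L)
    (hwidth : orderWidth L ≤ 2) (F : L → Type v) [∀ x, PartialOrder (F x)]
    (hF : ∀ x, IsTrLattice.{w} (F x)) : IsTrLattice.{w} (LexSum F) := by
  refine ⟨LexSum.isFiniteLattice hL fun x => (hF x).isFiniteLattice, ?_⟩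
  rintro α M hM ⟨e⟩
  have := hL.finite
  choose b hb using fun x => (hF x).isFiniteLattice.exists_isBot
  choose t ht using fun x => (hF x).isFiniteLattice.exists_isTop
  refine M.isTransversal_of_fibers hL.exists_join hwidth (p := fun Z => LexSum.index (e Z))
    (b := fun x => e.symm (LexSum.mk x (b x))) (t := fun x => e.symm (LexSum.mk x (t x)))
    (LexSum.index_mono.comp e.monotone)
    (fun Y Z h => e.le_iff_le.1 (LexSum.le_of_index_lt h)) (by simp) (by simp)
    (fun Z => e.symm_apply_le.2 ((LexSum.mk_le_iff_of_isBot (hb _)).2 le_rfl))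
    (fun Z => e.le_symm_apply.2 ((LexSum.le_mk_iff_of_isTop (ht _)).2 le_rfl)) fun x => ?_
  have hle : e.symm (LexSum.mk x (b x)) ≤ e.symm (LexSum.mk x (t x)) :=
    e.symm.monotone (LexSum.mk_le_mk_iff.2 (hb x (t x)))
  have hfin : (M.restrict (e.symm (LexSum.mk x (t x))).1).Finite :=
    ⟨Matroid.finite_of_subset_ground (e.symm (LexSum.mk x (t x))).2.1.subset_ground⟩
  refine (hF x).isTransversal _ _ inferInstance ⟨(Matroid.intervalIso hle).trans
    (LexSum.fiberIso e.symm (hb x) (ht x)).symm⟩
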